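/- For a permutation $\pi$ of $\{1,\dots,n\}$ let $D(\pi)=|\{i:1\le i\le n-1,\ \pi(i+1)<\pi(i)\}|$ be its number of descents, and let $T(\pi)=D(\pi)+D(\pi^{-1})$. Let $\pi$ be chosen uniformly from the symmetric group $S_n$. Then for every $n\ge 2$ $$\mathbb{E}(T(\pi))=n-1,\qquad \mathrm{Var}(T(\pi))=\frac{n+7}{6}-\frac1n .$$ As $n\to\infty$, the normalized variable $\dfrac{T(\pi)-\mathbb{E}(T(\pi))}{\sqrt{\mathrm{Var}(T(\pi))}}$ converges in distribution to the standard normal distribution $N(0,1)$. Moreover, there is a universal constant $C$ such that for every $n\ge2$ $$\delta_W\le C\,n^{-1/2},$$ where $\delta_W$ denotes the Wasserstein distance between the law of the normalized variable and $N(0,1)$, that is, the supremum of $|\int h\,d\mu-\int h\,d\nu|$ over all $1$-Lipschitz $h:\mathbb{R}\to\mathbb{R}$, where $\mu$ and $\nu$ are the two laws. -/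

import Mathlib

open MeasureTheory ProbabilityTheory Filter

/-- Number of descents of a permutation of `n` letters (positions and values are numbered
`0, …, n - 1`): the number of positions `i` with a successor such that `π (i + 1) < π i`. -/
def descents {n : ℕ} (π : Equiv.Perm (Fin n)) : ℕ :=
  (Finset.univ.filter fun i : Fin n => ∃ h : i.val + 1 < n, π ⟨i.val + 1, h⟩ < π i).card

/-- The statistic `T(π) = D(π) + D(π⁻¹)`, as a real random variable on `S_n`. -/
def descentT (n : ℕ) (π : Equiv.Perm (Fin n)) : ℝ :=
  (descents π : ℝ) + (descents π⁻¹ : ℝ)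

/-- The symmetric group carries the discrete sigma-algebra. -/
instance instMeasurableSpacePermFin (n : ℕ) : MeasurableSpace (Equiv.Perm (Fin n)) := ⊤

instance instDiscreteMeasurableSpacePermFin (n : ℕ) :
    DiscreteMeasurableSpace (Equiv.Perm (Fin n)) := ⟨fun _ => trivial⟩

/-- The uniform distribution on the symmetric group `S_n`. -/
noncomputable def uniformPerm (n : ℕ) : Measure (Equiv.Perm (Fin n)) :=
  (PMF.uniformOfFintype (Equiv.Perm (Fin n))).toMeasure

instance instIsProbabilityMeasureUniformPerm (n : ℕ) : IsProbabilityMeasure (uniformPerm n) := by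
  unfold uniformPerm
  infer_instance

/-- `T` normalized by its mean and variance: `(T - E T) / √(Var T)`. -/
noncomputable def normalizedT (n : ℕ) (π : Equiv.Perm (Fin n)) : ℝ :=
  (descentT n π - ∫ ρ, descentT n ρ ∂(uniformPerm n)) / √(Var[descentT n; uniformPerm n])

/-- The (Kantorovich-Rubinstein) Wasserstein distance of order one between two probability
measures on `ℝ`: the supremum of `|∫ h dμ - ∫ h dν|` over all 1-Lipschitz functions `h`.
For measures with finite first moments every 1-Lipschitz function is integrable. The
integrability clauses only keep the default value of a divergent integral out of the supremum
when a first moment is infinite. -/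
noncomputable def wassersteinDist (μ ν : Measure ℝ) : ENNReal :=
  ⨆ (h : ℝ → ℝ) (_ : LipschitzWith 1 h) (_ : Integrable h μ) (_ : Integrable h ν),
    ENNReal.ofReal |(∫ x, h x ∂μ) - ∫ x, h x ∂ν|

open scoped BigOperators

/-- The letter `k` of `{0, …, m}`; the values of interest are those with `k ≤ m`. -/
def letter (m k : ℕ) : Fin (m + 1) := Fin.ofNat (m + 1) k

lemma letter_val {m k : ℕ} (hk : k ≤ m) : (letter m k).val = k :=
  Nat.mod_eq_of_lt (Nat.lt_succ_of_le hk)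

lemma letter_inj {m k l : ℕ} (hk : k ≤ m) (hl : l ≤ m) : letter m k = letter m l ↔ k = l := by
  rw [Fin.ext_iff, letter_val hk, letter_val hl]

/-- The centred indicator of a descent from `a` to `b`. -/
noncomputable def descentSign {n : ℕ} (a b : Fin n) : ℝ := if b < a then 1 / 2 else -1 / 2

lemma descentSign_swap {n : ℕ} {a b : Fin n} (h : a ≠ b) :
    descentSign b a = -descentSign a b := by
  unfold descentSign
  rcases lt_or_gt_of_ne h with h | h
  · rw [if_pos h, if_neg h.not_gt]; norm_num
  · rw [if_neg h.not_gt, if_pos h]; norm_num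

lemma descentSign_mul_self {n : ℕ} (a b : Fin n) : descentSign a b * descentSign a b = 1 / 4 := by
  unfold descentSign; split_ifs <;> norm_num

lemma abs_descentSign {n : ℕ} (a b : Fin n) : |descentSign a b| = 1 / 2 := by
  unfold descentSign; split_ifs <;> norm_num [abs_of_pos, abs_div]

/-- The indicator that `b` lies strictly between `a` and `c`. -/
noncomputable def between {n : ℕ} (a b c : Fin n) : ℝ :=
  if a < b ∧ b < c ∨ c < b ∧ b < a then 1 else 0

lemma descentSign_triple {n : ℕ} {a b c : Fin n} (hab : a ≠ b) (hbc : b ≠ c) (hac : a ≠ c) :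
    descentSign a b * (descentSign b c - descentSign a c)
      + descentSign b c * (descentSign a b - descentSign a c) = (between a b c - 1) / 2 := by
  unfold descentSign between
  split_ifs <;> first | (norm_num; done) | (exfalso; omega)

lemma between_rotate {n : ℕ} {a b c : Fin n} (hab : a ≠ b) (hbc : b ≠ c) (hac : a ≠ c) :
    between a b c + between b c a + between c a b = 1 := by
  unfold between
  split_ifs <;> first | (norm_num; done) | (exfalso; omega)

lemma between_mem {n : ℕ} (a b c : Fin n) : 0 ≤ between a b c ∧ between a b c ≤ 1 := by
  unfold between; split_ifs <;> norm_num

/-- The centred number of descents. -/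
noncomputable def centredDescents {m : ℕ} (π : Equiv.Perm (Fin (m + 1))) : ℝ :=
  ∑ i ∈ Finset.range m, descentSign (π (letter m i)) (π (letter m (i + 1)))

/-- The centred version of `D(π) + D(π⁻¹)`. -/
noncomputable def centredT {m : ℕ} (π : Equiv.Perm (Fin (m + 1))) : ℝ :=
  centredDescents π + centredDescents π⁻¹

lemma centredT_inv {m : ℕ} (π : Equiv.Perm (Fin (m + 1))) : centredT π⁻¹ = centredT π := by
  simp [centredT, add_comm]

lemma descents_eq {m : ℕ} (π : Equiv.Perm (Fin (m + 1))) :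
    (descents π : ℝ) = m / 2 + centredDescents π := by
  have h1 : (descents π : ℝ) =
      ∑ i ∈ Finset.range (m + 1), if i < m ∧ π (letter m (i + 1)) < π (letter m i) then 1 else 0 := by
    unfold descents
    rw [Finset.card_filter, Nat.cast_sum, Finset.sum_range]
    refine Finset.sum_congr rfl fun i _ => ?_
    have e : letter m i.val = i := Fin.ext (letter_val (by omega))
    rw [Nat.cast_ite]
    simp only [Nat.cast_one, Nat.cast_zero, e]
    by_cases hi : i.val < m
    · have e' : letter m (i.val + 1) = ⟨i.val + 1, by omega⟩ := Fin.ext (letter_val (by omega))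
      simp [hi, e']
    · simp [hi]
  rw [h1, Finset.sum_range_succ]
  simp only [lt_irrefl, false_and, if_false, add_zero]
  have h2 : (m : ℝ) / 2 = ∑ i ∈ Finset.range m, (1 / 2 : ℝ) := by simp; ring
  rw [h2, centredDescents, ← Finset.sum_add_distrib]
  refine Finset.sum_congr rfl fun i hi => ?_
  unfold descentSign
  have := Finset.mem_range.1 hi
  simp only [this, true_and]
  split_ifs <;> norm_num

lemma descentT_eq {m : ℕ} (π : Equiv.Perm (Fin (m + 1))) :
    descentT (m + 1) π = m + centredT π := by
  rw [descentT, descents_eq, descents_eq, centredT]; ring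

/-- The transposition of the letters `i` and `i + 1`. -/
def adjSwap (m i : ℕ) : Equiv.Perm (Fin (m + 1)) := Equiv.swap (letter m i) (letter m (i + 1))

lemma adjSwap_left (m i : ℕ) : adjSwap m i (letter m i) = letter m (i + 1) :=
  Equiv.swap_apply_left _ _

lemma adjSwap_right (m i : ℕ) : adjSwap m i (letter m (i + 1)) = letter m i :=
  Equiv.swap_apply_right _ _

lemma adjSwap_of_ne {m i k : ℕ} (hi : i < m) (hk : k ≤ m) (h : k ≠ i) (h' : k ≠ i + 1) :
    adjSwap m i (letter m k) = letter m k :=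
  Equiv.swap_apply_of_ne_of_ne (by rwa [Ne, letter_inj hk hi.le]) (by rwa [Ne, letter_inj hk hi])

lemma adjSwap_val {m i : ℕ} (hi : i < m) (p : Fin (m + 1)) : (adjSwap m i p).val =
    if p.val = i then i + 1 else if p.val = i + 1 then i else p.val := by
  have e : p = letter m p.val := Fin.ext (letter_val (by omega)).symm
  split_ifs with h h'
  · rw [e, h, adjSwap_left, letter_val hi]
  · rw [e, h', adjSwap_right, letter_val hi.le]
  · rw [e, adjSwap_of_ne hi (by omega) h h', ← e]

/-- The indicator that the letters `i, i + 1` are mapped to `j, j + 1` in some order. -/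
noncomputable def adjacency {m : ℕ} (i j : ℕ) (π : Equiv.Perm (Fin (m + 1))) : ℝ :=
  if (π (letter m i) = letter m j ∧ π (letter m (i + 1)) = letter m (j + 1)) ∨
    (π (letter m i) = letter m (j + 1) ∧ π (letter m (i + 1)) = letter m j) then 1 else 0

lemma adjacency_nonneg {m : ℕ} (i j : ℕ) (π : Equiv.Perm (Fin (m + 1))) :
    0 ≤ adjacency i j π := by
  unfold adjacency; split_ifs <;> norm_num

lemma descentSign_adjSwap {m i : ℕ} (hi : i < m) {p q : Fin (m + 1)} (hpq : p ≠ q) :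
    descentSign p q - descentSign (adjSwap m i p) (adjSwap m i q) =
      if (p = letter m i ∧ q = letter m (i + 1)) ∨ (p = letter m (i + 1) ∧ q = letter m i)
      then 2 * descentSign p q else 0 := by
  have hv := Fin.val_ne_of_ne hpq
  simp only [descentSign, Fin.lt_def, adjSwap_val hi, Fin.ext_iff, letter_val hi.le,
    letter_val (Nat.succ_le_of_lt hi)]
  split_ifs <;> first | (norm_num; done) | (exfalso; omega)

lemma descentSign_inv_adjSwap {m i j : ℕ} (hi : i < m) (hj : j < m)
    (π : Equiv.Perm (Fin (m + 1))) :
    descentSign (π (letter m i)) (π (letter m (i + 1))) *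
      (descentSign (π⁻¹ (letter m j)) (π⁻¹ (letter m (j + 1))) -
        descentSign ((π * adjSwap m i)⁻¹ (letter m j)) ((π * adjSwap m i)⁻¹ (letter m (j + 1))))
      = adjacency i j π / 2 ∧
    |descentSign (π⁻¹ (letter m j)) (π⁻¹ (letter m (j + 1))) -
        descentSign ((π * adjSwap m i)⁻¹ (letter m j)) ((π * adjSwap m i)⁻¹ (letter m (j + 1)))|
      = adjacency i j π := by
  have hs : (adjSwap m i)⁻¹ = adjSwap m i := Equiv.swap_inv _ _
  have hne : letter m j ≠ letter m (j + 1) := by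
    rw [Ne, letter_inj hj.le hj]; omega
  rw [mul_inv_rev, hs, Equiv.Perm.mul_apply, Equiv.Perm.mul_apply,
    descentSign_adjSwap hi (fun h => hne (π⁻¹.injective h))]
  have hL := letter_val hi.le
  have hL' := letter_val (Nat.succ_le_of_lt hi)
  have hJ := letter_val hj.le
  have hJ' := letter_val (Nat.succ_le_of_lt hj)
  simp only [Equiv.Perm.inv_eq_iff_eq, adjacency]
  by_cases h1 : letter m j = π (letter m i) ∧ letter m (j + 1) = π (letter m (i + 1))
  · have e1 : π⁻¹ (letter m j) = letter m i := by rw [Equiv.Perm.inv_eq_iff_eq]; exact h1.1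
    have e2 : π⁻¹ (letter m (j + 1)) = letter m (i + 1) := by
      rw [Equiv.Perm.inv_eq_iff_eq]; exact h1.2
    rw [if_pos (Or.inl h1), if_pos (Or.inl ⟨h1.1.symm, h1.2.symm⟩), e1, e2, ← h1.1, ← h1.2]
    simp only [descentSign, Fin.lt_def, hL, hL', hJ, hJ']
    norm_num
  by_cases h2 : letter m j = π (letter m (i + 1)) ∧ letter m (j + 1) = π (letter m i)
  · have e1 : π⁻¹ (letter m j) = letter m (i + 1) := by rw [Equiv.Perm.inv_eq_iff_eq]; exact h2.1
    have e2 : π⁻¹ (letter m (j + 1)) = letter m i := by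
      rw [Equiv.Perm.inv_eq_iff_eq]; exact h2.2
    rw [if_pos (Or.inr h2), if_pos (Or.inr ⟨h2.2.symm, h2.1.symm⟩), e1, e2, ← h2.1, ← h2.2]
    simp only [descentSign, Fin.lt_def, hL, hL', hJ, hJ']
    norm_num
  · have h3 : ¬((π (letter m i) = letter m j ∧ π (letter m (i + 1)) = letter m (j + 1)) ∨
        (π (letter m i) = letter m (j + 1) ∧ π (letter m (i + 1)) = letter m j)) := by
      rintro (h | h)
      · exact h1 ⟨h.1.symm, h.2.symm⟩
      · exact h2 ⟨h.2.symm, h.1.symm⟩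
    rw [if_neg (by tauto), if_neg h3]
    simp

lemma sum_adjacency_le_one {m i : ℕ} (π : Equiv.Perm (Fin (m + 1))) :
    ∑ j ∈ Finset.range m, adjacency i j π ≤ 1 := by
  set k := min (π (letter m i)).val (π (letter m (i + 1))).val with hk
  calc ∑ j ∈ Finset.range m, adjacency i j π
      ≤ ∑ j ∈ Finset.range m, if j = k then (1 : ℝ) else 0 := by
        refine Finset.sum_le_sum fun j hj => ?_
        have hj := Finset.mem_range.1 hj
        unfold adjacency
        split_ifs with h1 h2 h2 <;> try norm_num
        apply h2
        rcases h1 with h | h <;> rw [hk, h.1, h.2, letter_val hj.le, letter_val hj] <;> simp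
    _ ≤ 1 := by
        rw [Finset.sum_ite_eq']; split_ifs <;> norm_num

lemma descentSign_mul_adjSwap_of_far {m i j : ℕ} (hi : i < m) (hj : j < m)
    (hij : i + 1 < j ∨ j + 1 < i) (π : Equiv.Perm (Fin (m + 1))) :
    descentSign ((π * adjSwap m i) (letter m j)) ((π * adjSwap m i) (letter m (j + 1))) =
      descentSign (π (letter m j)) (π (letter m (j + 1))) := by
  rw [Equiv.Perm.mul_apply, Equiv.Perm.mul_apply,
    adjSwap_of_ne hi (by omega) (by omega) (by omega),
    adjSwap_of_ne hi (by omega) (by omega) (by omega)]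

lemma abs_centredT_sub_le {m i : ℕ} (hi : i < m) (π : Equiv.Perm (Fin (m + 1))) :
    |centredT (π * adjSwap m i) - centredT π| ≤ 4 := by
  have h1 : |centredDescents π - centredDescents (π * adjSwap m i)| ≤ 3 := by
    unfold centredDescents
    rw [← Finset.sum_sub_distrib]
    refine (Finset.abs_sum_le_sum_abs _ _).trans ?_
    calc _ ≤ ∑ j ∈ Finset.range m, if j ∈ Finset.Icc (i - 1) (i + 1) then (1 : ℝ) else 0 := by
          refine Finset.sum_le_sum fun j hj => ?_
          have hj := Finset.mem_range.1 hj
          split_ifs with h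
          · refine (abs_sub _ _).trans ?_
            rw [abs_descentSign, abs_descentSign]; norm_num
          · rw [Finset.mem_Icc] at h
            rw [descentSign_mul_adjSwap_of_far hi hj (by omega), sub_self, abs_zero]
      _ ≤ ∑ j ∈ Finset.Icc (i - 1) (i + 1), (1 : ℝ) := by
          rw [← Finset.sum_filter]
          refine Finset.sum_le_sum_of_subset_of_nonneg ?_ fun _ _ _ => zero_le_one
          intro j hj
          exact (Finset.mem_filter.1 hj).2
      _ ≤ 3 := by
          rw [Finset.sum_const, Nat.card_Icc, nsmul_one]
          have : i + 1 + 1 - (i - 1) ≤ 3 := by omega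
          exact_mod_cast this
  have h2 : |centredDescents π⁻¹ - centredDescents (π * adjSwap m i)⁻¹| ≤ 1 := by
    unfold centredDescents
    rw [← Finset.sum_sub_distrib]
    refine (Finset.abs_sum_le_sum_abs _ _).trans ?_
    refine le_trans (le_of_eq (Finset.sum_congr rfl fun j hj => ?_))
      (sum_adjacency_le_one (i := i) π)
    exact (descentSign_inv_adjSwap hi (Finset.mem_range.1 hj) π).2
  rw [centredT, centredT, abs_le]
  rw [abs_le] at h1 h2
  constructor <;> linarith

lemma sum_banded (m : ℕ) (c : ℕ → ℕ → ℝ)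
    (hc : ∀ i j, i < m → j < m → i + 1 < j ∨ j + 1 < i → c i j = 0) :
    ∑ i ∈ Finset.range m, ∑ j ∈ Finset.range m, c i j =
      ∑ i ∈ Finset.range m, c i i + ∑ t ∈ Finset.range (m - 1), (c t (t + 1) + c (t + 1) t) := by
  induction m with
  | zero => simp
  | succ m ih =>
    have h := ih fun i j hi hj => hc i j (by omega) (by omega)
    rw [Finset.sum_range_succ, Finset.sum_range_succ (fun j => c m j)]
    simp_rw [Finset.sum_range_succ (fun j => c _ j) m]
    rw [Finset.sum_add_distrib, h]
    rcases m with _ | k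
    · simp
    · have e1 : ∑ i ∈ Finset.range (k + 1), c i (k + 1) = c k (k + 1) := by
        rw [Finset.sum_range_succ, Finset.sum_eq_zero, zero_add]
        intro i hi
        have := Finset.mem_range.1 hi
        exact hc _ _ (by omega) (by omega) (by omega)
      have e2 : ∑ i ∈ Finset.range (k + 1), c (k + 1) i = c (k + 1) k := by
        rw [Finset.sum_range_succ, Finset.sum_eq_zero, zero_add]
        intro i hi
        have := Finset.mem_range.1 hi
        exact hc _ _ (by omega) (by omega) (by omega)
      rw [e1, e2]
      simp only [Nat.add_sub_cancel]
      rw [Finset.sum_range_succ (fun t => c t (t + 1) + c (t + 1) t) k]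
      ring

/-- The indicator that the letter at `t + 1` is neither a peak nor a valley of `π`. -/
noncomputable def monotoneAt {m : ℕ} (t : ℕ) (π : Equiv.Perm (Fin (m + 1))) : ℝ :=
  between (π (letter m t)) (π (letter m (t + 1))) (π (letter m (t + 2)))

/-- The sum over adjacent transpositions of descent sign times the change of `T`. -/
noncomputable def steinFactor {m : ℕ} (π : Equiv.Perm (Fin (m + 1))) : ℝ :=
  ∑ i ∈ Finset.range m, descentSign (π (letter m i)) (π (letter m (i + 1))) *
    (centredT π - centredT (π * adjSwap m i))

lemma perm_letter_ne {m k l : ℕ} (hk : k ≤ m) (hl : l ≤ m) (h : k ≠ l)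
    (π : Equiv.Perm (Fin (m + 1))) : π (letter m k) ≠ π (letter m l) := by
  rwa [Ne, π.injective.eq_iff, letter_inj hk hl]

lemma steinFactor_eq {m : ℕ} (hm : 1 ≤ m) (π : Equiv.Perm (Fin (m + 1))) :
    steinFactor π = 1 / 2 + (∑ t ∈ Finset.range (m - 1), monotoneAt t π) / 2
      + (∑ i ∈ Finset.range m, ∑ j ∈ Finset.range m, adjacency i j π) / 2 := by
  set c : ℕ → ℕ → ℝ := fun i j => descentSign (π (letter m i)) (π (letter m (i + 1))) *
    (descentSign (π (letter m j)) (π (letter m (j + 1))) -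
      descentSign ((π * adjSwap m i) (letter m j)) ((π * adjSwap m i) (letter m (j + 1)))) with hc
  have h0 : steinFactor π = ∑ i ∈ Finset.range m, ∑ j ∈ Finset.range m, c i j +
      (∑ i ∈ Finset.range m, ∑ j ∈ Finset.range m, adjacency i j π) / 2 := by
    rw [Finset.sum_div, ← Finset.sum_add_distrib, steinFactor]
    refine Finset.sum_congr rfl fun i hi => ?_
    have hi := Finset.mem_range.1 hi
    rw [Finset.sum_div, ← Finset.mul_sum, Finset.sum_sub_distrib]
    have : ∑ j ∈ Finset.range m, adjacency i j π / 2 =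
        descentSign (π (letter m i)) (π (letter m (i + 1))) *
          (centredDescents π⁻¹ - centredDescents (π * adjSwap m i)⁻¹) := by
      unfold centredDescents
      rw [← Finset.sum_sub_distrib, Finset.mul_sum]
      refine Finset.sum_congr rfl fun j hj => ?_
      exact (descentSign_inv_adjSwap hi (Finset.mem_range.1 hj) π).1.symm
    rw [this, centredT, centredT]
    change _ = descentSign (π (letter m i)) (π (letter m (i + 1))) *
      (centredDescents π - centredDescents (π * adjSwap m i)) + _
    ring
  rw [h0, sum_banded m c]
  · have e1 : ∑ i ∈ Finset.range m, c i i = m / 2 := by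
      rw [Finset.sum_congr rfl (g := fun _ => (1 / 2 : ℝ))]
      · simp; ring
      intro i hi
      have hi := Finset.mem_range.1 hi
      simp only [hc, Equiv.Perm.mul_apply, adjSwap_left, adjSwap_right]
      rw [descentSign_swap (perm_letter_ne hi.le hi (by omega) π)]
      linarith [descentSign_mul_self (π (letter m i)) (π (letter m (i + 1)))]
    have e2 : ∑ t ∈ Finset.range (m - 1), (c t (t + 1) + c (t + 1) t) =
        ∑ t ∈ Finset.range (m - 1), (monotoneAt t π / 2 - 1 / 2) := by
      refine Finset.sum_congr rfl fun t ht => ?_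
      have ht := Finset.mem_range.1 ht
      have := descentSign_triple (perm_letter_ne (m := m) (k := t) (l := t + 1) (by omega)
        (by omega) (by omega) π) (perm_letter_ne (m := m) (k := t + 1) (l := t + 2) (by omega)
        (by omega) (by omega) π) (perm_letter_ne (m := m) (k := t) (l := t + 2) (by omega)
        (by omega) (by omega) π)
      simp only [hc, Equiv.Perm.mul_apply, adjSwap_left, adjSwap_right]
      rw [adjSwap_of_ne (m := m) (i := t) (k := t + 1 + 1) (by omega) (by omega) (by omega)
        (by omega), adjSwap_of_ne (m := m) (i := t + 1) (k := t) (by omega) (by omega) (by omega)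
        (by omega), monotoneAt]
      linarith
    rw [e1, e2, Finset.sum_sub_distrib, ← Finset.sum_div]
    simp only [Finset.sum_const, Finset.card_range, nsmul_eq_mul, Nat.cast_sub hm]
    push_cast
    ring
  · intro i j hi hj hij
    simp only [hc, descentSign_mul_adjSwap_of_far hi hj hij, sub_self, mul_zero]

section Expectation

variable {m : ℕ}

lemma expect_mul_right {n : ℕ} (τ : Equiv.Perm (Fin n)) (g : Equiv.Perm (Fin n) → ℝ) :
    𝔼 π, g (π * τ) = 𝔼 π, g π :=
  Fintype.expect_equiv (Equiv.mulRight τ) _ _ fun _ => rfl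

lemma expect_mul_left {n : ℕ} (τ : Equiv.Perm (Fin n)) (g : Equiv.Perm (Fin n) → ℝ) :
    𝔼 π, g (τ * π) = 𝔼 π, g π :=
  Fintype.expect_equiv (Equiv.mulLeft τ) _ _ fun _ => rfl

lemma expect_inv {n : ℕ} (g : Equiv.Perm (Fin n) → ℝ) : 𝔼 π, g π⁻¹ = 𝔼 π, g π :=
  Fintype.expect_equiv (Equiv.inv _) _ _ fun _ => rfl

lemma expect_le_expect_of_le {ι : Type*} [Fintype ι] {f g : ι → ℝ} (h : ∀ i, f i ≤ g i) :
    𝔼 i, f i ≤ 𝔼 i, g i :=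
  Finset.expect_le_expect fun i _ => h i

lemma expect_descentSign_mul {i : ℕ} (hi : i < m) (g : Equiv.Perm (Fin (m + 1)) → ℝ) :
    𝔼 π, descentSign (π (letter m i)) (π (letter m (i + 1))) * (g π - g (π * adjSwap m i)) =
      2 * 𝔼 π, descentSign (π (letter m i)) (π (letter m (i + 1))) * g π := by
  have h := expect_mul_right (adjSwap m i) fun π : Equiv.Perm (Fin (m + 1)) =>
    descentSign (π (letter m i)) (π (letter m (i + 1))) * g (π * adjSwap m i)
  have hs : adjSwap m i * adjSwap m i = 1 := Equiv.swap_mul_self _ _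
  simp only [mul_assoc, hs, mul_one, Equiv.Perm.mul_apply, adjSwap_left, adjSwap_right] at h
  have h' : ∀ π : Equiv.Perm (Fin (m + 1)),
      descentSign (π (letter m (i + 1))) (π (letter m i)) * g π =
        -(descentSign (π (letter m i)) (π (letter m (i + 1))) * g π) := fun π => by
    rw [descentSign_swap (perm_letter_ne hi.le hi (by omega) π)]; ring
  simp only [h', Finset.expect_neg_distrib] at h
  simp only [mul_sub, Finset.expect_sub_distrib]
  linarith

/-- Stein's identity for the centred statistic, by exchanging adjacent letters. -/
lemma expect_centredT_mul (φ : ℝ → ℝ) :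
    𝔼 π : Equiv.Perm (Fin (m + 1)), centredT π * φ (centredT π) =
      𝔼 π : Equiv.Perm (Fin (m + 1)), ∑ i ∈ Finset.range m,
        descentSign (π (letter m i)) (π (letter m (i + 1))) *
          (φ (centredT π) - φ (centredT (π * adjSwap m i))) := by
  have h1 : 𝔼 π : Equiv.Perm (Fin (m + 1)), centredT π * φ (centredT π) =
      2 * 𝔼 π : Equiv.Perm (Fin (m + 1)), centredDescents π * φ (centredT π) := by
    have h := expect_inv fun π : Equiv.Perm (Fin (m + 1)) => centredDescents π * φ (centredT π)
    simp only [centredT_inv] at h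
    have : ∀ π : Equiv.Perm (Fin (m + 1)), centredT π * φ (centredT π) =
        centredDescents π * φ (centredT π) + centredDescents π⁻¹ * φ (centredT π) :=
      fun π => by rw [← add_mul]; rfl
    simp only [this, Finset.expect_add_distrib, h]
    ring
  rw [h1, Finset.expect_sum_comm]
  simp only [centredDescents, Finset.sum_mul]
  rw [Finset.expect_sum_comm, Finset.mul_sum]
  refine Finset.sum_congr rfl fun i hi => ?_
  rw [expect_descentSign_mul (Finset.mem_range.1 hi) fun π => φ (centredT π)]

lemma expect_centredT : 𝔼 π : Equiv.Perm (Fin (m + 1)), centredT π = 0 := by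
  simpa using expect_centredT_mul (m := m) fun _ => 1

lemma expect_centredT_sq : 𝔼 π : Equiv.Perm (Fin (m + 1)), centredT π ^ 2 =
    𝔼 π : Equiv.Perm (Fin (m + 1)), steinFactor π := by
  simpa [sq, steinFactor] using expect_centredT_mul (m := m) id

lemma expect_monotoneAt_mul {t : ℕ} (ht : t + 2 ≤ m) (g : Equiv.Perm (Fin (m + 1)) → ℝ)
    (hg : ∀ π, g (π * (adjSwap m t * adjSwap m (t + 1))) = g π) :
    𝔼 π, monotoneAt t π * g π = (𝔼 π, g π) / 3 := by
  set ρ := adjSwap m t * adjSwap m (t + 1) with hρ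
  have r1 : ρ (letter m t) = letter m (t + 1) := by
    rw [hρ, Equiv.Perm.mul_apply, adjSwap_of_ne (by omega) (by omega) (by omega) (by omega),
      adjSwap_left]
  have r2 : ρ (letter m (t + 1)) = letter m (t + 2) := by
    rw [hρ, Equiv.Perm.mul_apply, adjSwap_left, adjSwap_of_ne (by omega) (by omega) (by omega)
      (by omega)]
  have r3 : ρ (letter m (t + 2)) = letter m t := by
    rw [hρ, Equiv.Perm.mul_apply, adjSwap_right, adjSwap_right]
  have h1 := expect_mul_right ρ fun π => monotoneAt t π * g π
  have h2 := expect_mul_right ρ fun π => monotoneAt t (π * ρ) * g (π * ρ)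
  simp only [hg, monotoneAt, Equiv.Perm.mul_apply, r1, r2, r3] at h1 h2
  have h3 : 𝔼 π, g π = 𝔼 π : Equiv.Perm (Fin (m + 1)),
      (between (π (letter m t)) (π (letter m (t + 1))) (π (letter m (t + 2))) * g π
      + between (π (letter m (t + 1))) (π (letter m (t + 2))) (π (letter m t)) * g π
      + between (π (letter m (t + 2))) (π (letter m t)) (π (letter m (t + 1))) * g π) := by
    refine Finset.expect_congr rfl fun π _ => ?_
    rw [← add_mul, ← add_mul, between_rotate (perm_letter_ne (by omega) (by omega) (by omega) π)
      (perm_letter_ne (by omega) (by omega) (by omega) π)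
      (perm_letter_ne (by omega) (by omega) (by omega) π), one_mul]
  rw [Finset.expect_add_distrib, Finset.expect_add_distrib] at h3
  simp only [monotoneAt]
  linarith

lemma expect_monotoneAt {t : ℕ} (ht : t + 2 ≤ m) :
    𝔼 π : Equiv.Perm (Fin (m + 1)), monotoneAt t π = 1 / 3 := by
  simpa using expect_monotoneAt_mul ht (fun _ => 1) fun _ => rfl

lemma expect_monotoneAt_sub_mul {t u : ℕ} (ht : t + 2 ≤ m) (hu : u + 2 ≤ m)
    (htu : t + 2 < u ∨ u + 2 < t) :
    𝔼 π : Equiv.Perm (Fin (m + 1)), (monotoneAt t π - 1 / 3) * (monotoneAt u π - 1 / 3) = 0 := by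
  have h := expect_monotoneAt_mul ht (fun π => monotoneAt u π - 1 / 3) fun π => by
    have r : ∀ k, k = u ∨ k = u + 1 ∨ k = u + 2 →
        (π * (adjSwap m t * adjSwap m (t + 1))) (letter m k) = π (letter m k) := fun k hk => by
      rw [Equiv.Perm.mul_apply, Equiv.Perm.mul_apply,
        adjSwap_of_ne (by omega) (by omega) (by omega) (by omega),
        adjSwap_of_ne (by omega) (by omega) (by omega) (by omega)]
    simp only [monotoneAt, r u (by simp), r (u + 1) (by simp), r (u + 2) (by simp)]
  have h' := Finset.mul_expect Finset.univ
    (fun π : Equiv.Perm (Fin (m + 1)) => monotoneAt u π - 1 / 3) (1 / 3 : ℝ)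
  refine (Finset.expect_congr rfl fun π _ => sub_mul _ _ _).trans ?_
  rw [Finset.expect_sub_distrib, h, ← h']
  ring

lemma expect_sum_monotoneAt_sq_le :
    𝔼 π : Equiv.Perm (Fin (m + 1)), (∑ t ∈ Finset.range (m - 1), (monotoneAt t π - 1 / 3)) ^ 2 ≤
      5 * m := by
  have h1 : ∀ π : Equiv.Perm (Fin (m + 1)),
      (∑ t ∈ Finset.range (m - 1), (monotoneAt t π - 1 / 3)) ^ 2 =
        ∑ t ∈ Finset.range (m - 1), ∑ u ∈ Finset.range (m - 1),
          (monotoneAt t π - 1 / 3) * (monotoneAt u π - 1 / 3) := fun π => by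
    rw [sq, Finset.sum_mul_sum]
  simp only [h1, Finset.expect_sum_comm]
  calc _ ≤ ∑ t ∈ Finset.range (m - 1), (5 : ℝ) := by
        refine Finset.sum_le_sum fun t ht => ?_
        have ht := Finset.mem_range.1 ht
        calc _ ≤ ∑ u ∈ Finset.range (m - 1),
              if u ∈ Finset.Icc (t - 2) (t + 2) then (1 : ℝ) else 0 := by
              refine Finset.sum_le_sum fun u hu => ?_
              have hu := Finset.mem_range.1 hu
              split_ifs with h
              · refine Finset.expect_le Finset.univ_nonempty fun π _ => ?_
                have b1 := between_mem (π (letter m t)) (π (letter m (t + 1)))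
                  (π (letter m (t + 2)))
                have b2 := between_mem (π (letter m u)) (π (letter m (u + 1)))
                  (π (letter m (u + 2)))
                simp only [monotoneAt]
                refine (abs_le.1 ?_).2
                rw [abs_mul]
                refine mul_le_one₀ ?_ (abs_nonneg _) ?_ <;> rw [abs_le] <;>
                  constructor <;> linarith
              · rw [Finset.mem_Icc] at h
                rw [expect_monotoneAt_sub_mul (by omega) (by omega) (by omega)]
          _ ≤ ∑ u ∈ Finset.Icc (t - 2) (t + 2), (1 : ℝ) := by
              rw [← Finset.sum_filter]
              refine Finset.sum_le_sum_of_subset_of_nonneg ?_ fun _ _ _ => zero_le_one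
              intro j hj
              exact (Finset.mem_filter.1 hj).2
          _ ≤ 5 := by
              rw [Finset.sum_const, Nat.card_Icc, nsmul_one]
              have : t + 2 + 1 - (t - 2) ≤ 5 := by omega
              exact_mod_cast this
    _ ≤ 5 * m := by
        rw [Finset.sum_const, Finset.card_range, nsmul_eq_mul, mul_comm]
        have : ((m - 1 : ℕ) : ℝ) ≤ m := by exact_mod_cast Nat.sub_le m 1
        linarith

lemma exists_perm_apply_eq {α : Type*} [DecidableEq α] {c d c' d' : α} (h : c ≠ d)
    (h' : c' ≠ d') : ∃ g : Equiv.Perm α, g c = c' ∧ g d = d' := by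
  refine ⟨Equiv.swap (Equiv.swap c c' d) d' * Equiv.swap c c', ?_, ?_⟩
  · rw [Equiv.Perm.mul_apply, Equiv.swap_apply_left, Equiv.swap_apply_of_ne_of_ne _ h']
    intro e
    rw [eq_comm, Equiv.swap_apply_eq_iff, Equiv.swap_apply_right] at e
    exact h e.symm
  · rw [Equiv.Perm.mul_apply, Equiv.swap_apply_left]

lemma expect_indicator_two {n : ℕ} {a b c d : Fin n} (hab : a ≠ b) (hcd : c ≠ d) :
    𝔼 π : Equiv.Perm (Fin n), (if π a = c ∧ π b = d then (1 : ℝ) else 0) =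
      1 / (n * (n - 1)) := by
  have hsum : ∑ p ∈ (Finset.univ : Finset (Fin n)).offDiag, 𝔼 π : Equiv.Perm (Fin n),
      (if π a = p.1 ∧ π b = p.2 then (1 : ℝ) else 0) = 1 := by
    rw [← Finset.expect_sum_comm]
    rw [← Fintype.expect_const (ι := Equiv.Perm (Fin n)) (1 : ℝ)]
    refine Finset.expect_congr rfl fun π _ => ?_
    rw [Finset.sum_eq_single (π a, π b)]
    · simp
    · intro p _ hp
      rw [if_neg]
      rintro ⟨h1, h2⟩
      exact hp (Prod.ext h1.symm h2.symm)
    · intro h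
      exact absurd (Finset.mem_offDiag.2 ⟨Finset.mem_univ _, Finset.mem_univ _,
        fun e => hab (π.injective e)⟩) h
  have hconst : ∀ p ∈ (Finset.univ : Finset (Fin n)).offDiag, 𝔼 π : Equiv.Perm (Fin n),
      (if π a = p.1 ∧ π b = p.2 then (1 : ℝ) else 0) =
      𝔼 π : Equiv.Perm (Fin n), (if π a = c ∧ π b = d then (1 : ℝ) else 0) := by
    intro p hp
    obtain ⟨g, g1, g2⟩ := exists_perm_apply_eq hcd (Finset.mem_offDiag.1 hp).2.2
    rw [← expect_mul_left g]
    simp only [Equiv.Perm.mul_apply, ← g1, ← g2, g.injective.eq_iff]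
  rw [Finset.sum_congr rfl hconst, Finset.sum_const, Finset.offDiag_card, nsmul_eq_mul] at hsum
  rw [Finset.card_univ, Fintype.card_fin, Nat.cast_sub (Nat.le_mul_self n)] at hsum
  push_cast at hsum
  have hne : (n : ℝ) * (n - 1) ≠ 0 := by
    intro h
    have : (n : ℝ) * n - n = 0 := by linarith
    rw [this, zero_mul] at hsum
    exact zero_ne_one hsum
  rw [eq_div_iff hne]
  linarith

lemma expect_adjacency {i j : ℕ} (hi : i < m) (hj : j < m) :
    𝔼 π : Equiv.Perm (Fin (m + 1)), adjacency i j π = 2 / ((m + 1) * m) := by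
  have hne : ∀ {k}, k < m → letter m k ≠ letter m (k + 1) := fun {k} hk => by
    rw [Ne, letter_inj hk.le hk]; omega
  have h : ∀ π : Equiv.Perm (Fin (m + 1)), adjacency i j π =
      (if π (letter m i) = letter m j ∧ π (letter m (i + 1)) = letter m (j + 1)
        then (1 : ℝ) else 0) +
      (if π (letter m i) = letter m (j + 1) ∧ π (letter m (i + 1)) = letter m j
        then (1 : ℝ) else 0) := fun π => by
    unfold adjacency
    by_cases h1 : π (letter m i) = letter m j ∧ π (letter m (i + 1)) = letter m (j + 1)
    · have h2 : ¬(π (letter m i) = letter m (j + 1) ∧ π (letter m (i + 1)) = letter m j) :=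
        fun h => hne hj (h1.1.symm.trans h.1)
      rw [if_pos (Or.inl h1), if_pos h1, if_neg h2, add_zero]
    · simp only [h1, false_or, if_false, zero_add]
  simp only [h, Finset.expect_add_distrib]
  rw [expect_indicator_two (hne hi) (hne hj), expect_indicator_two (hne hi) (hne hj).symm]
  push_cast
  ring

/-- The number of adjacent pairs of letters with adjacent images. -/
noncomputable def adjacencyCount (π : Equiv.Perm (Fin (m + 1))) : ℝ :=
  ∑ i ∈ Finset.range m, ∑ j ∈ Finset.range m, adjacency i j π

lemma adjacencyCount_nonneg (π : Equiv.Perm (Fin (m + 1))) : 0 ≤ adjacencyCount π :=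
  Finset.sum_nonneg fun _ _ => Finset.sum_nonneg fun _ _ => adjacency_nonneg _ _ _

lemma adjacencyCount_le (π : Equiv.Perm (Fin (m + 1))) : adjacencyCount π ≤ m := by
  refine (Finset.sum_le_sum fun i _ => sum_adjacency_le_one (i := i) π).trans ?_
  simp

lemma expect_adjacencyCount (hm : 1 ≤ m) :
    𝔼 π : Equiv.Perm (Fin (m + 1)), adjacencyCount π = 2 * m / (m + 1) := by
  have hm' : (0 : ℝ) < m := by exact_mod_cast hm
  simp only [adjacencyCount, Finset.expect_sum_comm]
  rw [Finset.sum_congr rfl fun i hi => Finset.sum_congr rfl fun j hj =>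
    expect_adjacency (Finset.mem_range.1 hi) (Finset.mem_range.1 hj)]
  simp only [Finset.sum_const, Finset.card_range, nsmul_eq_mul]
  field_simp

lemma expect_adjacencyCount_sq_le (hm : 1 ≤ m) :
    𝔼 π : Equiv.Perm (Fin (m + 1)), adjacencyCount π ^ 2 ≤ 2 * m := by
  calc _ ≤ 𝔼 π : Equiv.Perm (Fin (m + 1)), m * adjacencyCount π :=
        expect_le_expect_of_le fun π => by
          rw [sq]
          exact mul_le_mul_of_nonneg_right (adjacencyCount_le π) (adjacencyCount_nonneg π)
    _ = m * (2 * m / (m + 1)) := by rw [← Finset.mul_expect, expect_adjacencyCount hm]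
    _ ≤ 2 * m := by
        have : (2 * m / (m + 1) : ℝ) ≤ 2 := by
          rw [div_le_iff₀ (by positivity)]; linarith
        have h0 : (0 : ℝ) ≤ m := by positivity
        nlinarith

lemma expect_steinFactor (hm : 1 ≤ m) :
    𝔼 π : Equiv.Perm (Fin (m + 1)), steinFactor π = ((m : ℝ) + 8) / 6 - 1 / (m + 1) := by
  have h : ∀ π : Equiv.Perm (Fin (m + 1)), steinFactor π =
      1 / 2 + (∑ t ∈ Finset.range (m - 1), monotoneAt t π) / 2 + adjacencyCount π / 2 :=
    steinFactor_eq hm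
  simp only [h, Finset.expect_add_distrib, ← Finset.expect_div, Finset.expect_sum_comm]
  rw [expect_adjacencyCount hm, Finset.sum_congr rfl fun t ht =>
    expect_monotoneAt (m := m) (t := t) (by have := Finset.mem_range.1 ht; omega),
    Fintype.expect_const]
  simp only [Finset.sum_const, Finset.card_range, nsmul_eq_mul, Nat.cast_sub hm]
  field_simp
  push_cast
  ring

lemma expect_steinFactor_sub_sq_le (hm : 1 ≤ m) :
    𝔼 π : Equiv.Perm (Fin (m + 1)),
      (steinFactor π - 𝔼 ρ : Equiv.Perm (Fin (m + 1)), steinFactor ρ) ^ 2 ≤ 4 * m := by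
  set e : ℝ := 𝔼 π : Equiv.Perm (Fin (m + 1)), adjacencyCount π with he
  have hmean : 𝔼 ρ : Equiv.Perm (Fin (m + 1)), steinFactor ρ =
      1 / 2 + ((m - 1 : ℕ) : ℝ) / 6 + e / 2 := by
    rw [expect_steinFactor hm, he, expect_adjacencyCount hm, Nat.cast_sub hm]
    field_simp
    push_cast
    ring
  have h1 : ∀ π : Equiv.Perm (Fin (m + 1)),
      (steinFactor π - 𝔼 ρ : Equiv.Perm (Fin (m + 1)), steinFactor ρ) ^ 2 ≤
      (∑ t ∈ Finset.range (m - 1), (monotoneAt t π - 1 / 3)) ^ 2 / 2 +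
        (adjacencyCount π ^ 2 - 2 * e * adjacencyCount π + e ^ 2) / 2 := fun π => by
    have : steinFactor π = 1 / 2 + (∑ t ∈ Finset.range (m - 1), monotoneAt t π) / 2 +
      adjacencyCount π / 2 := steinFactor_eq hm π
    rw [hmean, this, Finset.sum_sub_distrib, Finset.sum_const, Finset.card_range, nsmul_eq_mul]
    nlinarith [sq_nonneg ((∑ t ∈ Finset.range (m - 1), monotoneAt t π) -
      ((m - 1 : ℕ) : ℝ) * (1 / 3) - (adjacencyCount π - e))]
  refine (expect_le_expect_of_le h1).trans ?_
  simp only [Finset.expect_add_distrib, Finset.expect_sub_distrib, ← Finset.expect_div,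
    ← Finset.mul_expect, Fintype.expect_const, ← he]
  have h2 := expect_sum_monotoneAt_sq_le (m := m)
  have h3 := expect_adjacencyCount_sq_le hm
  have h4 : (0 : ℝ) ≤ m := by positivity
  nlinarith [sq_nonneg e]

end Expectation

section SteinEquation

open Topology

lemma hasDerivAt_exp_neg_sq_half (x : ℝ) :
    HasDerivAt (fun x : ℝ => Real.exp (-x ^ 2 / 2)) (-x * Real.exp (-x ^ 2 / 2)) x := by
  have h : HasDerivAt (fun x : ℝ => -x ^ 2 / 2) (-x) x := by
    convert! ((hasDerivAt_pow 2 x).neg.div_const 2) using 1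
    simp
    ring
  convert! h.exp using 1
  ring

lemma tendsto_affine_mul_exp_neg_sq_half (α β : ℝ) :
    Tendsto (fun x : ℝ => (α + β * |x|) * Real.exp (-x ^ 2 / 2)) (cocompact ℝ) (𝓝 0) := by
  have h0 := (tendsto_rpow_abs_mul_exp_neg_mul_sq_cocompact (a := 1 / 2) (by norm_num) 0).const_mul α
  have h1 := (tendsto_rpow_abs_mul_exp_neg_mul_sq_cocompact (a := 1 / 2) (by norm_num) 1).const_mul β
  simp only [Real.rpow_zero, Real.rpow_one, mul_zero] at h0 h1
  convert! h0.add h1 using 2 with x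
  · rw [show -x ^ 2 / 2 = -(1 / 2) * x ^ 2 by ring]; ring
  · simp

lemma tendsto_exp_neg_sq_half_mul {u : ℝ → ℝ} {α β : ℝ} (hu : ∀ x, |u x| ≤ α + β * |x|) :
    Tendsto (fun x : ℝ => Real.exp (-x ^ 2 / 2) * u x) (cocompact ℝ) (𝓝 0) := by
  refine squeeze_zero_norm (fun x => ?_) (tendsto_affine_mul_exp_neg_sq_half α β)
  rw [Real.norm_eq_abs, abs_mul, abs_of_pos (Real.exp_pos _), mul_comm]
  exact mul_le_mul_of_nonneg_right (hu x) (Real.exp_pos _).le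

lemma le_of_hasDerivAt_ornstein {u κ : ℝ → ℝ} {A B : ℝ} (hA : 0 ≤ A) (hB : 0 ≤ B)
    (hu : ∀ x, HasDerivAt u (x * u x + κ x) x) (hκ : ∀ x, 0 ≤ x → |κ x| ≤ A + B * x)
    (hlim : Tendsto (fun x => Real.exp (-x ^ 2 / 2) * u x) atTop (𝓝 0)) {x : ℝ} (hx : 0 ≤ x) :
    u x ≤ 2 * A / (1 + x) + B := by
  set b : ℝ → ℝ := fun x => 2 * A / (1 + x) + B with hb
  set G : ℝ → ℝ := fun x => Real.exp (-x ^ 2 / 2) * (u x - b x) with hG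
  have hbd : ∀ x, 0 ≤ x → HasDerivAt b (-(2 * A) / (1 + x) ^ 2) x := fun x hx => by
    have h1 : HasDerivAt (fun x : ℝ => 1 + x) 1 x := (hasDerivAt_id x).const_add 1
    convert! ((hasDerivAt_const x (2 * A)).div h1 (by positivity)).add_const B using 1
    simp
  have hGd : ∀ x, 0 ≤ x → HasDerivAt G (-x * Real.exp (-x ^ 2 / 2) * (u x - b x) +
      Real.exp (-x ^ 2 / 2) * (x * u x + κ x - -(2 * A) / (1 + x) ^ 2)) x := fun x hx =>
    (hasDerivAt_exp_neg_sq_half x).mul ((hu x).sub (hbd x hx))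
  have hmono : MonotoneOn G (Set.Ici 0) := by
    refine monotoneOn_of_deriv_nonneg (convex_Ici 0)
      (fun x hx => (hGd x hx).continuousAt.continuousWithinAt) ?_ ?_
    · rw [interior_Ici]
      exact fun x hx => (hGd x (le_of_lt hx)).differentiableAt.differentiableWithinAt
    · rw [interior_Ici]
      intro x hx
      have hx : 0 < x := hx
      rw [(hGd x hx.le).deriv]
      have h1 := (abs_le.1 (hκ x hx.le)).1
      have h2 : A ≤ x * (2 * A / (1 + x)) + 2 * A / (1 + x) ^ 2 := by
        have : x * (2 * A / (1 + x)) + 2 * A / (1 + x) ^ 2 - A =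
            A * (1 + x ^ 2) / (1 + x) ^ 2 := by
          field_simp; ring
        have : 0 ≤ A * (1 + x ^ 2) / (1 + x) ^ 2 := by positivity
        linarith
      have : -x * Real.exp (-x ^ 2 / 2) * (u x - b x) +
          Real.exp (-x ^ 2 / 2) * (x * u x + κ x - -(2 * A) / (1 + x) ^ 2) =
          Real.exp (-x ^ 2 / 2) * (κ x + B * x + (x * (2 * A / (1 + x)) +
            2 * A / (1 + x) ^ 2)) := by
        simp only [hb]; ring
      rw [this]
      exact mul_nonneg (Real.exp_pos _).le (by linarith)
  have hGlim : Tendsto G atTop (𝓝 0) := by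
    have h1 := (tendsto_affine_mul_exp_neg_sq_half (2 * A + B) 0).mono_left atTop_le_cocompact
    have h2 : Tendsto (fun x => Real.exp (-x ^ 2 / 2) * b x) atTop (𝓝 0) := by
      refine squeeze_zero' ?_ ?_ h1
      · filter_upwards [eventually_ge_atTop 0] with x hx
        simp only [hb]
        positivity
      · filter_upwards [eventually_ge_atTop 0] with x hx
        rw [mul_comm, zero_mul, add_zero]
        refine mul_le_mul_of_nonneg_right ?_ (Real.exp_pos _).le
        have : 2 * A / (1 + x) ≤ 2 * A := div_le_self (by positivity) (by linarith)
        simp only [hb]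
        linarith
    simpa [hG, mul_sub] using hlim.sub h2
  have hle : G x ≤ 0 := by
    refine ge_of_tendsto hGlim ?_
    filter_upwards [eventually_ge_atTop x] with y hy
    exact hmono hx (hx.trans hy) hy
  have := nonpos_of_mul_nonpos_right hle (Real.exp_pos _)
  linarith

/-- A priori bound for the decaying solution of `u' - x u = κ`. -/
lemma abs_le_of_hasDerivAt_ornstein {u κ : ℝ → ℝ} {A B : ℝ} (hA : 0 ≤ A) (hB : 0 ≤ B)
    (hu : ∀ x, HasDerivAt u (x * u x + κ x) x) (hκ : ∀ x, |κ x| ≤ A + B * |x|)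
    (hlim : Tendsto (fun x => Real.exp (-x ^ 2 / 2) * u x) (cocompact ℝ) (𝓝 0)) (x : ℝ) :
    |u x| ≤ 2 * A / (1 + |x|) + B := by
  have key : ∀ (v κ' : ℝ → ℝ), (∀ x, HasDerivAt v (x * v x + κ' x) x) →
      (∀ x, |κ' x| ≤ A + B * |x|) →
      Tendsto (fun x => Real.exp (-x ^ 2 / 2) * v x) (cocompact ℝ) (𝓝 0) →
      ∀ x, 0 ≤ x → |v x| ≤ 2 * A / (1 + x) + B := by
    intro v κ' hv hκ' hl x hx
    have hl' := hl.mono_left atTop_le_cocompact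
    rw [abs_le']
    refine ⟨le_of_hasDerivAt_ornstein hA hB hv
      (fun y hy => by simpa [abs_of_nonneg hy] using hκ' y) hl' hx,
      le_of_hasDerivAt_ornstein (u := fun x => -v x) (κ := fun x => -κ' x) hA hB
      (fun y => ?_) (fun y hy => by simpa [abs_of_nonneg hy] using hκ' y)
      (by simpa using hl'.neg) hx⟩
    convert! (hv y).neg using 1
    ring
  rcases le_total 0 x with hx | hx
  · rw [abs_of_nonneg hx]
    exact key u κ hu hκ hlim x hx
  · have h := key (fun y => u (-y)) (fun y => -κ (-y)) (fun y => ?_)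
      (fun y => by simpa using hκ (-y)) ?_ (-x) (by linarith)
    · rw [abs_of_nonpos hx]
      simpa using h
    · convert! (hu (-y)).scomp y (hasDerivAt_neg y) using 1
      simp; ring
    · have := hlim.comp (Homeomorph.neg ℝ).isClosedEmbedding.tendsto_cocompact
      simpa [Function.comp_def] using this

lemma integrable_gaussianReal_of_lipschitz {h : ℝ → ℝ} (hh : LipschitzWith 1 h) :
    Integrable h (gaussianReal 0 1) := by
  have h1 : Integrable (fun x : ℝ => x) (gaussianReal 0 1) :=
    memLp_one_iff_integrable.1 (memLp_id_gaussianReal 1)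
  refine ((integrable_const |h 0|).add h1.abs).mono' hh.continuous.aestronglyMeasurable
    (Eventually.of_forall fun x => ?_)
  have h2 := hh.dist_le_mul x 0
  rw [Real.dist_eq, Real.dist_eq] at h2
  simp only [NNReal.coe_one, one_mul, sub_zero] at h2
  have := abs_sub_abs_le_abs_sub (h x) (h 0)
  simp only [Real.norm_eq_abs, Pi.add_apply]
  linarith

/-- The first absolute moment of the standard Gaussian distribution. -/
noncomputable def gaussianAbsMoment : ℝ := ∫ x, |x| ∂(gaussianReal 0 1)

lemma gaussianAbsMoment_nonneg : 0 ≤ gaussianAbsMoment :=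
  integral_nonneg fun _ => abs_nonneg _

lemma abs_sub_integral_gaussianReal_le {h : ℝ → ℝ} (hh : LipschitzWith 1 h) (x : ℝ) :
    |h x - ∫ y, h y ∂(gaussianReal 0 1)| ≤ gaussianAbsMoment + 1 * |x| := by
  have hi := integrable_gaussianReal_of_lipschitz hh
  have h1 : Integrable (fun x : ℝ => x) (gaussianReal 0 1) :=
    memLp_one_iff_integrable.1 (memLp_id_gaussianReal 1)
  have e : h x - ∫ y, h y ∂(gaussianReal 0 1) = ∫ y, (h x - h y) ∂(gaussianReal 0 1) := by
    rw [integral_sub (integrable_const _) hi, integral_const]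
    simp
  have e2 : gaussianAbsMoment + 1 * |x| = ∫ y, (|y| + |x|) ∂(gaussianReal 0 1) := by
    rw [integral_add h1.abs (integrable_const _), integral_const, gaussianAbsMoment]
    simp
  rw [e, e2]
  refine (abs_integral_le_integral_abs).trans
    (integral_mono ((integrable_const _).sub hi).abs (h1.abs.add (integrable_const _)) fun y => ?_)
  have h2 := hh.dist_le_mul x y
  rw [Real.dist_eq, Real.dist_eq] at h2
  simp only [NNReal.coe_one, one_mul] at h2
  have := abs_sub x y
  simp only
  linarith

/-- Stein's equation with bounds on the first two derivatives of the solution. -/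
lemma exists_stein_solution {h h' : ℝ → ℝ} (hh : ∀ x, HasDerivAt h (h' x) x)
    (hb : ∀ x, |h' x| ≤ 1) :
    ∃ f f' f'' : ℝ → ℝ, (∀ x, HasDerivAt f (f' x) x) ∧ (∀ x, HasDerivAt f' (f'' x) x) ∧
      (∀ x, |f' x| ≤ 6 * gaussianAbsMoment + 6) ∧ (∀ x, |f'' x| ≤ 6 * gaussianAbsMoment + 6) ∧
      ∀ x, f' x - x * f x = h x - ∫ y, h y ∂(gaussianReal 0 1) := by
  set a := gaussianAbsMoment with ha_def
  have ha : 0 ≤ a := gaussianAbsMoment_nonneg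
  have hl : LipschitzWith 1 h := lipschitzWith_of_nnnorm_deriv_le
    (fun x => (hh x).differentiableAt) fun x => by
      rw [(hh x).deriv, ← NNReal.coe_le_coe, coe_nnnorm]
      simpa using hb x
  set c := ∫ y, h y ∂(gaussianReal 0 1) with hc
  set k : ℝ → ℝ := fun x => Real.exp (-x ^ 2 / 2) * (h x - c) with hk
  have hkc : Continuous k := by
    have := hl.continuous
    simp only [hk]
    fun_prop
  have hpdf : ∀ x : ℝ, gaussianPDFReal 0 1 x = (√(2 * Real.pi))⁻¹ * Real.exp (-x ^ 2 / 2) := by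
    intro x
    simp [gaussianPDFReal]
  have hki : Integrable k := by
    have i1 : Integrable fun x : ℝ => a * Real.exp (-(1 / 2) * x ^ 2) :=
      (integrable_exp_neg_mul_sq (by norm_num)).const_mul a
    have i2 : Integrable fun x : ℝ => x * Real.exp (-(1 / 2) * x ^ 2) :=
      integrable_mul_exp_neg_mul_sq (by norm_num)
    refine (i1.add i2.abs).mono' hkc.aestronglyMeasurable (Eventually.of_forall fun x => ?_)
    have := abs_sub_integral_gaussianReal_le hl x
    simp only [hk, Real.norm_eq_abs, abs_mul, abs_of_pos (Real.exp_pos _), Pi.add_apply]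
    rw [show -x ^ 2 / 2 = -(1 / 2) * x ^ 2 by ring, mul_comm, ← add_mul]
    refine mul_le_mul_of_nonneg_right ?_ (Real.exp_pos _).le
    rw [← hc] at this
    linarith
  have hk0 : ∫ x, k x = 0 := by
    have h1 : ∫ x, (h x - c) ∂(gaussianReal 0 1) = 0 := by
      rw [integral_sub (integrable_gaussianReal_of_lipschitz hl) (integrable_const _),
        integral_const]
      simp [hc]
    rw [integral_gaussianReal_eq_integral_smul one_ne_zero] at h1
    simp only [hpdf, smul_eq_mul, mul_assoc] at h1
    rw [integral_const_mul] at h1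
    refine (mul_eq_zero.1 h1).resolve_left (inv_ne_zero ?_)
    positivity
  set F : ℝ → ℝ := fun x => (∫ y in (0 : ℝ)..x, k y) - ∫ y in Set.Ioi (0 : ℝ), k y with hF
  have hFd : ∀ x, HasDerivAt F (k x) x := fun x =>
    (intervalIntegral.integral_hasDerivAt_right (hkc.intervalIntegrable _ _)
      (hkc.stronglyMeasurableAtFilter _ _) hkc.continuousAt).sub_const _
  have hFlim : Tendsto F (cocompact ℝ) (𝓝 0) := by
    rw [cocompact_eq_atBot_atTop, tendsto_sup]
    constructor
    · have h1 := (intervalIntegral_tendsto_integral_Iic 0 hki.integrableOn tendsto_id).neg.sub_const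
        (∫ y in Set.Ioi (0 : ℝ), k y)
      have h2 := intervalIntegral.integral_Iic_add_Ioi (b := (0 : ℝ)) (f := k) (μ := volume)
        hki.integrableOn hki.integrableOn
      rw [hk0] at h2
      rw [show -(∫ x in Set.Iic 0, k x) - ∫ y in Set.Ioi (0 : ℝ), k y = 0 by linarith] at h1
      refine h1.congr fun x => ?_
      simp only [hF, id]
      rw [intervalIntegral.integral_symm x 0]
    · have h1 := (intervalIntegral_tendsto_integral_Ioi 0 hki.integrableOn tendsto_id).sub_const
        (∫ y in Set.Ioi (0 : ℝ), k y)
      rw [sub_self] at h1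
      exact h1
  set f : ℝ → ℝ := fun x => Real.exp (x ^ 2 / 2) * F x with hf
  have hexp : ∀ x : ℝ, Real.exp (x ^ 2 / 2) * Real.exp (-x ^ 2 / 2) = 1 := fun x => by
    rw [← Real.exp_add]; ring_nf; simp
  have hfd : ∀ x, HasDerivAt f (x * f x + (h x - c)) x := fun x => by
    have h1 : HasDerivAt (fun x : ℝ => x ^ 2 / 2) x x := by
      convert! ((hasDerivAt_pow 2 x).div_const 2) using 1
      simp
    convert! h1.exp.mul (hFd x) using 1
    simp only [hf, hk]
    rw [← mul_assoc (Real.exp (x ^ 2 / 2)), hexp]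
    ring
  have hfb : ∀ x, |f x| ≤ 2 * a + 1 := fun x => by
    refine (abs_le_of_hasDerivAt_ornstein ha zero_le_one hfd
      (fun x => abs_sub_integral_gaussianReal_le hl x) ?_ x).trans ?_
    · refine hFlim.congr fun x => ?_
      simp only [hf]
      rw [← mul_assoc, mul_comm (Real.exp _), hexp, one_mul]
    · have : 2 * a / (1 + |x|) ≤ 2 * a :=
        div_le_self (by positivity) (by linarith [abs_nonneg x])
      linarith
  set g : ℝ → ℝ := fun x => x * f x + (h x - c) with hg
  have hgd : ∀ x, HasDerivAt g (x * g x + (f x + h' x)) x := fun x => by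
    convert! ((hasDerivAt_id x).mul (hfd x)).add ((hh x).sub_const c) using 1
    simp only [hg, id]
    ring
  have hκ : ∀ x, |f x + h' x| ≤ (2 * a + 2) + 0 * |x| := fun x => by
    refine (abs_add_le _ _).trans ?_
    linarith [hfb x, hb x]
  have hgb : ∀ x, |g x| ≤ 2 * (2 * a + 2) / (1 + |x|) + 0 := by
    refine abs_le_of_hasDerivAt_ornstein (by positivity) le_rfl hgd hκ
      (tendsto_exp_neg_sq_half_mul (α := a) (β := 2 * a + 2) fun x => ?_)
    refine (abs_add_le _ _).trans ?_
    have h1 := abs_sub_integral_gaussianReal_le hl x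
    have h2 := mul_le_mul_of_nonneg_left (hfb x) (abs_nonneg x)
    rw [abs_mul]
    linarith
  refine ⟨f, g, fun x => x * g x + (f x + h' x), hfd, hgd, fun x => ?_, fun x => ?_, fun x => ?_⟩
  · refine (hgb x).trans ?_
    have : 2 * (2 * a + 2) / (1 + |x|) ≤ 2 * (2 * a + 2) :=
      div_le_self (by positivity) (by linarith [abs_nonneg x])
    linarith
  · have h1 : |x * g x| ≤ 2 * (2 * a + 2) := by
      rw [abs_mul]
      refine (mul_le_mul_of_nonneg_left (hgb x) (abs_nonneg x)).trans ?_
      rw [add_zero, ← mul_div_assoc, div_le_iff₀ (by positivity)]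
      nlinarith [abs_nonneg x]
    refine (abs_add_le _ _).trans ?_
    have := hκ x
    linarith
  · simp only [hg]
    ring

end SteinEquation

section NormalApproximation

open Topology

lemma abs_sub_sub_mul_le {f f' : ℝ → ℝ} {K : ℝ} (hf : ∀ x, HasDerivAt f (f' x) x)
    (hK : 0 ≤ K) (hf' : ∀ x y, |f' y - f' x| ≤ K * |y - x|) (x y : ℝ) :
    |f y - f x - f' x * (y - x)| ≤ K * (y - x) ^ 2 := by
  have h := (convex_uIcc x y).norm_image_sub_le_of_norm_hasDerivWithin_le
    (f := fun z => f z - f' x * z) (f' := fun z => f' z - f' x) (C := K * |y - x|)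
    (fun z _ => by
      simpa [Pi.sub_def] using
        ((hf z).sub ((hasDerivAt_id z).const_mul (f' x))).hasDerivWithinAt)
    (fun z hz => ?_) Set.left_mem_uIcc Set.right_mem_uIcc
  · rw [Real.norm_eq_abs, Real.norm_eq_abs, mul_assoc, ← sq, sq_abs] at h
    convert h using 2
    ring
  · refine (hf' x z).trans (mul_le_mul_of_nonneg_left ?_ hK)
    exact Set.abs_sub_left_of_mem_uIcc hz

lemma abs_sub_le_of_hasDerivAt {f f' : ℝ → ℝ} {K : ℝ} (hf : ∀ x, HasDerivAt f (f' x) x)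
    (hb : ∀ x, |f' x| ≤ K) (x y : ℝ) : |f y - f x| ≤ K * |y - x| :=
  convex_univ.norm_image_sub_le_of_norm_hasDerivWithin_le
    (fun z _ => (hf z).hasDerivWithinAt) (fun z _ => hb z) (Set.mem_univ x) (Set.mem_univ y)

/-- A 1-Lipschitz function is a uniform limit of differentiable 1-Lipschitz functions. -/
lemma exists_hasDerivAt_near {h : ℝ → ℝ} (hh : LipschitzWith 1 h) {ε : ℝ} (hε : 0 < ε) :
    ∃ g g' : ℝ → ℝ, (∀ x, HasDerivAt g (g' x) x) ∧ (∀ x, |g' x| ≤ 1) ∧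
      ∀ x, |g x - h x| ≤ ε := by
  have hl : ∀ x y, |h y - h x| ≤ 1 * |y - x| := fun x y => by
    simpa [Real.dist_eq] using hh.dist_le_mul y x
  set H : ℝ → ℝ := fun x => ∫ t in (0 : ℝ)..x, h t with hH
  have hHd : ∀ x, HasDerivAt H (h x) x := fun x =>
    intervalIntegral.integral_hasDerivAt_right (hh.continuous.intervalIntegrable _ _)
      (hh.continuous.stronglyMeasurableAtFilter _ _) hh.continuous.continuousAt
  refine ⟨fun x => (H (x + ε) - H x) / ε, fun x => (h (x + ε) - h x) / ε, fun x => ?_,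
    fun x => ?_, fun x => ?_⟩
  · exact (((hHd (x + ε)).comp_add_const x ε).sub (hHd x)).div_const ε
  · have := hl x (x + ε)
    rw [add_sub_cancel_left, abs_of_pos hε] at this
    rw [abs_div, abs_of_pos hε, div_le_one hε]
    linarith
  · have := abs_sub_sub_mul_le hHd zero_le_one hl x (x + ε)
    rw [add_sub_cancel_left] at this
    have e : (H (x + ε) - H x) / ε - h x = (H (x + ε) - H x - h x * ε) / ε := by
      field_simp
    rw [e, abs_div, abs_of_pos hε, div_le_iff₀ hε]
    linarith

lemma integral_uniformPerm {n : ℕ} (g : Equiv.Perm (Fin n) → ℝ) :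
    ∫ π, g π ∂(uniformPerm n) = 𝔼 π, g π := by
  rw [uniformPerm, PMF.integral_eq_sum, Fintype.expect_eq_sum_div_card, Finset.sum_div]
  refine Finset.sum_congr rfl fun π _ => ?_
  rw [PMF.uniformOfFintype_apply, ENNReal.toReal_inv, ENNReal.toReal_natCast, smul_eq_mul]
  ring

lemma abs_expect_le {ι : Type*} [Fintype ι] [Nonempty ι] {g : ι → ℝ} {C : ℝ}
    (h : ∀ i, |g i| ≤ C) : |𝔼 i, g i| ≤ C :=
  (Finset.abs_expect_le _ _).trans (Finset.expect_le Finset.univ_nonempty fun i _ => h i)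

variable {m : ℕ}

/-- The variance of the two-sided descent statistic on `m + 1` letters. -/
noncomputable def varianceT (m : ℕ) : ℝ := ((m : ℝ) + 8) / 6 - 1 / (m + 1)

lemma le_varianceT (hm : 1 ≤ m) : ((m : ℝ) + 1) / 6 ≤ varianceT m := by
  have hm' : (1 : ℝ) ≤ m := by exact_mod_cast hm
  have : 1 / ((m : ℝ) + 1) ≤ 1 := by rw [div_le_one (by positivity)]; linarith
  unfold varianceT
  linarith

lemma expect_abs_steinFactor_sub_le (hm : 1 ≤ m) :
    𝔼 π : Equiv.Perm (Fin (m + 1)), |steinFactor π - varianceT m| ≤ 2 * √m := by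
  have hs : 0 < √(m : ℝ) := Real.sqrt_pos.2 (by exact_mod_cast hm)
  have hs2 : √(m : ℝ) ^ 2 = m := Real.sq_sqrt (by positivity)
  have h := expect_steinFactor_sub_sq_le hm
  rw [expect_steinFactor hm] at h
  change 𝔼 π : Equiv.Perm (Fin (m + 1)), (steinFactor π - varianceT m) ^ 2 ≤ 4 * m at h
  calc _ ≤ 𝔼 π : Equiv.Perm (Fin (m + 1)),
        ((steinFactor π - varianceT m) ^ 2 / (4 * √m) + √m) := by
        refine expect_le_expect_of_le fun π => ?_
        rw [← sq_abs (steinFactor π - varianceT m), ← sub_nonneg]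
        have : |steinFactor π - varianceT m| ^ 2 / (4 * √m) + √m - |steinFactor π - varianceT m| =
            (|steinFactor π - varianceT m| - 2 * √m) ^ 2 / (4 * √m) := by
          field_simp
          ring
        rw [this]
        positivity
    _ ≤ 2 * √m := by
        rw [Finset.expect_add_distrib, ← Finset.expect_div, Fintype.expect_const]
        have : (𝔼 π : Equiv.Perm (Fin (m + 1)), (steinFactor π - varianceT m) ^ 2) / (4 * √m) ≤
            √m := by
          rw [div_le_iff₀ (by positivity)]
          nlinarith
        linarith

lemma abs_expect_stein_le (hm : 1 ≤ m) {f f' f'' : ℝ → ℝ} {K : ℝ} (hK : 0 ≤ K)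
    (hf : ∀ x, HasDerivAt f (f' x) x) (hf' : ∀ x, HasDerivAt f' (f'' x) x)
    (hb : ∀ x, |f' x| ≤ K) (hb' : ∀ x, |f'' x| ≤ K) :
    |𝔼 π : Equiv.Perm (Fin (m + 1)), (f' (centredT π / √(varianceT m)) -
      centredT π / √(varianceT m) * f (centredT π / √(varianceT m)))| ≤
        132 * K / √((m : ℝ) + 1) := by
  set V := varianceT m with hV
  set σ := √V with hσ
  have hV6 : ((m : ℝ) + 1) / 6 ≤ V := le_varianceT hm
  have hVpos : 0 < V := lt_of_lt_of_le (by positivity) hV6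
  have hσpos : 0 < σ := Real.sqrt_pos.2 hVpos
  have hσ2 : σ ^ 2 = V := Real.sq_sqrt hVpos.le
  set r := √((m : ℝ) + 1) with hr
  have hrpos : 0 < r := Real.sqrt_pos.2 (by positivity)
  have hr2 : r ^ 2 = m + 1 := Real.sq_sqrt (by positivity)
  have hid := expect_centredT_mul (m := m) fun y => f (y / σ)
  have hpt : ∀ π : Equiv.Perm (Fin (m + 1)),
      |f' (centredT π / σ) * steinFactor π / σ - ∑ i ∈ Finset.range m,
        descentSign (π (letter m i)) (π (letter m (i + 1))) *
          (f (centredT π / σ) - f (centredT (π * adjSwap m i) / σ))| ≤ m * (8 * K / V) := by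
    intro π
    rw [steinFactor, Finset.mul_sum, Finset.sum_div, ← Finset.sum_sub_distrib]
    refine (Finset.abs_sum_le_sum_abs _ _).trans ?_
    calc _ ≤ ∑ i ∈ Finset.range m, 8 * K / V := by
          refine Finset.sum_le_sum fun i hi => ?_
          have h1 := abs_sub_sub_mul_le hf hK (abs_sub_le_of_hasDerivAt hf' hb')
            (centredT π / σ) (centredT (π * adjSwap m i) / σ)
          have h2 := abs_centredT_sub_le (Finset.mem_range.1 hi) π
          have h3 : (centredT (π * adjSwap m i) - centredT π) ^ 2 ≤ 16 := by
            rw [← sq_abs]; nlinarith [abs_nonneg (centredT (π * adjSwap m i) - centredT π)]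
          have h4 : (centredT (π * adjSwap m i) / σ - centredT π / σ) ^ 2 ≤ 16 / V := by
            rw [← sub_div, div_pow, hσ2]
            exact div_le_div_of_nonneg_right h3 hVpos.le
          have e : ∀ s a b x y : ℝ, x * (s * (a - b)) / σ - s * (y - f (b / σ)) =
              s * (f (b / σ) - y - x * (b / σ - a / σ)) := fun s a b x y => by
            field_simp; ring
          rw [e, abs_mul, abs_descentSign]
          have h5 := mul_le_mul_of_nonneg_left h4 hK
          have h6 : 8 * K / V = 1 / 2 * (K * (16 / V)) := by ring
          rw [h6]
          linarith
      _ = m * (8 * K / V) := by rw [Finset.sum_const, Finset.card_range, nsmul_eq_mul]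
  have e1 : 𝔼 π : Equiv.Perm (Fin (m + 1)),
      (f' (centredT π / σ) - centredT π / σ * f (centredT π / σ)) =
      (𝔼 π : Equiv.Perm (Fin (m + 1)), f' (centredT π / σ) * (V - steinFactor π)) / V +
      (𝔼 π : Equiv.Perm (Fin (m + 1)), (f' (centredT π / σ) * steinFactor π / σ -
        ∑ i ∈ Finset.range m, descentSign (π (letter m i)) (π (letter m (i + 1))) *
          (f (centredT π / σ) - f (centredT (π * adjSwap m i) / σ)))) / σ := by
    rw [Finset.expect_sub_distrib (f := fun π => f' (centredT π / σ) * steinFactor π / σ), ← hid,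
      ← Finset.expect_sub_distrib, Finset.expect_div, Finset.expect_div,
      ← Finset.expect_add_distrib]
    refine Finset.expect_congr rfl fun π _ => ?_
    rw [← hσ2]
    field_simp
    ring
  have b1 : |𝔼 π : Equiv.Perm (Fin (m + 1)), f' (centredT π / σ) * (V - steinFactor π)| ≤
      K * (2 * √m) := by
    refine (Finset.abs_expect_le _ _).trans ?_
    have h := mul_le_mul_of_nonneg_left (expect_abs_steinFactor_sub_le hm) hK
    rw [Finset.mul_expect] at h
    refine le_trans (expect_le_expect_of_le fun π => ?_) h
    rw [abs_mul, abs_sub_comm]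
    exact mul_le_mul_of_nonneg_right (hb _) (abs_nonneg _)
  have b2 := abs_expect_le hpt
  have hVr : r ^ 2 / 6 ≤ V := by rwa [hr2]
  have hσr : r / (5 / 2) ≤ σ := by
    refine le_of_sq_le_sq ?_ hσpos.le
    rw [hσ2, div_pow]
    exact (div_le_div_of_nonneg_left (sq_nonneg r) (by norm_num) (by norm_num)).trans hVr
  have hmr : √(m : ℝ) ≤ r := Real.sqrt_le_sqrt (by linarith)
  rw [e1]
  refine (abs_add_le _ _).trans ?_
  rw [abs_div, abs_div, abs_of_pos hVpos, abs_of_pos hσpos]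
  have c1 : |𝔼 π : Equiv.Perm (Fin (m + 1)), f' (centredT π / σ) * (V - steinFactor π)| / V ≤
      12 * K / r := by
    calc _ ≤ K * (2 * r) / (r ^ 2 / 6) := by
          refine div_le_div₀ (by positivity) (b1.trans ?_) (by positivity) hVr
          exact mul_le_mul_of_nonneg_left (by linarith) hK
      _ = 12 * K / r := by field_simp; ring
  have c2 : (m : ℝ) * (8 * K / V) ≤ 48 * K := by
    calc _ ≤ r ^ 2 * (8 * K / (r ^ 2 / 6)) := by
          refine mul_le_mul (by linarith) ?_ (by positivity) (by positivity)
          exact div_le_div_of_nonneg_left (by positivity) (by positivity) hVr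
      _ = 48 * K := by field_simp; ring
  have c3 := div_le_div₀ (by positivity) (b2.trans c2) (by positivity) hσr
  have c4 : 48 * K / (r / (5 / 2)) = 120 * K / r := by field_simp; ring
  have c5 : 132 * K / r = 12 * K / r + 120 * K / r := by ring
  rw [c4] at c3
  rw [c5]
  exact add_le_add c1 c3

lemma abs_expect_sub_integral_gaussianReal_le (hm : 1 ≤ m) {h : ℝ → ℝ}
    (hh : LipschitzWith 1 h) :
    |𝔼 π : Equiv.Perm (Fin (m + 1)), h (centredT π / √(varianceT m)) -
      ∫ x, h x ∂(gaussianReal 0 1)| ≤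
        132 * (6 * gaussianAbsMoment + 6) / √((m : ℝ) + 1) := by
  refine le_of_forall_pos_le_add fun ε hε => ?_
  obtain ⟨g, g', hg, hg', hgh⟩ := exists_hasDerivAt_near hh (half_pos hε)
  obtain ⟨f, f', f'', hf, hf', hb, hb', heq⟩ := exists_stein_solution hg hg'
  have h1 := abs_expect_stein_le hm (by linarith [gaussianAbsMoment_nonneg]) hf hf' hb hb'
  simp only [heq, Finset.expect_sub_distrib, Fintype.expect_const] at h1
  have h2 : |𝔼 π : Equiv.Perm (Fin (m + 1)), (g (centredT π / √(varianceT m)) -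
      h (centredT π / √(varianceT m)))| ≤ ε / 2 := abs_expect_le fun π => hgh _
  rw [Finset.expect_sub_distrib] at h2
  have hgl : LipschitzWith 1 g := lipschitzWith_of_nnnorm_deriv_le
    (fun x => (hg x).differentiableAt) fun x => by
      rw [(hg x).deriv, ← NNReal.coe_le_coe, coe_nnnorm]
      simpa using hg' x
  have h3 : |∫ x, g x ∂(gaussianReal 0 1) - ∫ x, h x ∂(gaussianReal 0 1)| ≤ ε / 2 := by
    rw [← integral_sub (integrable_gaussianReal_of_lipschitz hgl)
      (integrable_gaussianReal_of_lipschitz hh)]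
    have := norm_integral_le_of_norm_le_const (μ := gaussianReal 0 1)
      (f := fun x => g x - h x) (Eventually.of_forall hgh)
    simpa using this
  rw [abs_le] at h1 h2 h3 ⊢
  constructor <;> linarith

lemma integral_descentT : ∫ π, descentT (m + 1) π ∂(uniformPerm (m + 1)) = m := by
  rw [integral_uniformPerm]
  simp only [descentT_eq, Finset.expect_add_distrib, Fintype.expect_const, expect_centredT,
    add_zero]

lemma variance_descentT (hm : 1 ≤ m) :
    Var[descentT (m + 1); uniformPerm (m + 1)] = varianceT m := by
  rw [variance_eq_integral (Measurable.of_discrete.aemeasurable), integral_descentT,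
    integral_uniformPerm]
  simp only [descentT_eq, add_sub_cancel_left]
  rw [expect_centredT_sq, expect_steinFactor hm, varianceT]

lemma normalizedT_eq (hm : 1 ≤ m) (π : Equiv.Perm (Fin (m + 1))) :
    normalizedT (m + 1) π = centredT π / √(varianceT m) := by
  rw [normalizedT, integral_descentT, variance_descentT hm, descentT_eq, add_sub_cancel_left]

/-- The constant in the Wasserstein bound. -/
noncomputable def wassersteinConst : ℝ := 132 * (6 * gaussianAbsMoment + 6)

lemma abs_integral_normalizedT_sub_le {n : ℕ} (hn : 2 ≤ n) {h : ℝ → ℝ}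
    (hh : LipschitzWith 1 h) :
    |∫ x, h x ∂((uniformPerm n).map (normalizedT n)) - ∫ x, h x ∂(gaussianReal 0 1)| ≤
      wassersteinConst / √(n : ℝ) := by
  obtain ⟨m, rfl⟩ : ∃ m, n = m + 1 := ⟨n - 1, by omega⟩
  rw [integral_map Measurable.of_discrete.aemeasurable hh.continuous.aestronglyMeasurable,
    integral_uniformPerm]
  have := abs_expect_sub_integral_gaussianReal_le (m := m) (by omega) hh
  simp only [normalizedT_eq (m := m) (by omega)]
  push_cast
  exact this

lemma tendstoInDistribution_normalizedT :
    TendstoInDistribution normalizedT atTop (id : ℝ → ℝ) uniformPerm (gaussianReal 0 1) where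
  forall_aemeasurable _ := Measurable.of_discrete.aemeasurable
  tendsto := by
    refine tendsto_iff_forall_lipschitz_integral_tendsto.2 ?_
    rintro f - ⟨L, hL⟩
    simp only [ProbabilityMeasure.coe_mk, Measure.map_id]
    set c : ℝ := L + 1 with hc
    have hcpos : 0 < c := by positivity
    have hlip : LipschitzWith 1 fun x => f x / c := by
      refine LipschitzWith.of_dist_le_mul fun x y => ?_
      have h := hL.dist_le_mul x y
      rw [Real.dist_eq] at h ⊢
      rw [← sub_div, abs_div, abs_of_pos hcpos, div_le_iff₀ hcpos, NNReal.coe_one, one_mul]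
      have : (0 : ℝ) ≤ dist x y := dist_nonneg
      nlinarith
    rw [tendsto_iff_dist_tendsto_zero]
    have h0 : Tendsto (fun n : ℕ => c * (wassersteinConst / √(n : ℝ))) atTop (𝓝 0) := by
      have := (tendsto_const_nhds (x := wassersteinConst)).div_atTop
        (Real.tendsto_sqrt_atTop.comp tendsto_natCast_atTop_atTop)
      simpa using this.const_mul c
    refine squeeze_zero' (Eventually.of_forall fun _ => dist_nonneg) ?_ h0
    filter_upwards [eventually_ge_atTop 2] with n hn
    have h := abs_integral_normalizedT_sub_le hn hlip
    rw [integral_div, integral_div, ← sub_div, abs_div, abs_of_pos hcpos,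
      div_le_iff₀ hcpos] at h
    rw [Real.dist_eq]
    linarith

end NormalApproximation

theorem theorem1 :
    (∀ n : ℕ, 2 ≤ n →
      ∫ π, descentT n π ∂(uniformPerm n) = (n : ℝ) - 1 ∧
      Var[descentT n; uniformPerm n] = ((n : ℝ) + 7) / 6 - 1 / (n : ℝ)) ∧
    TendstoInDistribution normalizedT atTop (id : ℝ → ℝ) uniformPerm (gaussianReal 0 1) ∧
    (∃ C : ℝ, ∀ n : ℕ, 2 ≤ n →
      wassersteinDist ((uniformPerm n).map (normalizedT n)) (gaussianReal 0 1) ≤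
        ENNReal.ofReal (C / √(n : ℝ))) := by
  refine ⟨fun n hn => ?_, tendstoInDistribution_normalizedT, wassersteinConst, fun n hn => ?_⟩
  · obtain ⟨m, rfl⟩ : ∃ m, n = m + 1 := ⟨n - 1, by omega⟩
    rw [integral_descentT, variance_descentT (by omega), varianceT]
    push_cast
    constructor <;> ring
  · exact iSup_le fun h => iSup_le fun hh => iSup_le fun _ => iSup_le fun _ =>
      ENNReal.ofReal_le_ofReal (abs_integral_normalizedT_sub_le hn hh)
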